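/- Let $k\le n$ and let $\Lambda_1,\dots,\Lambda_k\subset(\mathbb C^n)^*$ be nonempty finite sets of linear functionals. Let $S=S(\Lambda_1,\dots,\Lambda_k)$ be the space of systems $f=(f_1,\dots,f_k)$ of exponential sums $f_i(z)=\sum_{\lambda\in\Lambda_i}c_{i,\lambda}e^{\lambda(z)}$ with $c_{i,\lambda}\in\mathbb C$ (zero coefficients are allowed), and let $Y(f)$ be the exponential variety with equations $f_1=\dots=f_k=0$. For a finitely generated subgroup $G\subset(\mathbb C^n)^*$ that contains a basis of $(\mathbb C^n)^*$ and all exponents of the $f_i$, write $f_i(z)=P_i(\omega_G(z))$, where $P_i$ is a Laurent polynomial on the torus $\mathbb T_G=\mathrm{Hom}(G,\mathbb C\setminus 0)$ and $\omega_G(z)$ is the character $g\mapsto e^{g(z)}$. The algebraic variety $\{P_1=\dots=P_k=0\}\subset\mathbb T_G$ is the $G$-model of $Y(f)$, and the algebraic codimension of $Y(f)$ is the codimension of its model in $\mathbb T_G$. Then there is a nonzero polynomial $R$ in the coefficients $c_{i,\lambda}$ such that one of the following holds: (a) for all $f\in S$ with $R(f)\neq0$, every $G$-model of $Y(f)$ has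 codimension exactly $k$, that is, the algebraic codimension of $Y(f)$ is exactly $k$; (b) for all $f\in S$ with $R(f)\ne0$, every $G$-model of $Y(f)$ is empty. In the logarithmic coordinates $c_{i,\lambda}=e^{a_{i,\lambda}}$ the equation $R=0$ defines an exponential hypersurface $\mathfrak D=\{a: R(e^{a})=0\}$, the zero set of an exponential sum in the variables $a_{i,\lambda}$ that does not vanish identically. So, for the systems with coefficients $e^{a_{i,\lambda}}$, the alternative (a) or (b) holds outside the exponential hypersurface $\mathfrak D$. The equation $R=0$ is an exponential analogue of the resultant. -/

import Mathlib

open scoped ENat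

noncomputable section

namespace ExpGeom

/-- Exponential sums `∑ c_λ e^{λ(z)}` on a complex vector space `V`, recorded by their finitely
supported coefficient functions on the dual space; the product is the product of functions. -/
abbrev ExpSum (V : Type*) [AddCommGroup V] [Module ℂ V] : Type _ :=
  AddMonoidAlgebra ℂ (Module.Dual ℂ V)

section Windings

variable {V : Type*} [AddCommGroup V] [Module ℂ V]

/-- The points of the character torus `T_G` of a subgroup `G` of the dual space: the characters
`G → ℂ \ 0`. -/
abbrev Torus (G : AddSubgroup (Module.Dual ℂ V)) : Type _ := Multiplicative G →* ℂˣ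

/-- The value at a point `τ` of the torus `T_G` of a Laurent polynomial `∑ c_g g`, that is
`∑ c_g τ(g)`. -/
def laurentEval {G : AddSubgroup (Module.Dual ℂ V)} (τ : Torus G) : AddMonoidAlgebra ℂ G →ₐ[ℂ] ℂ :=
  AddMonoidAlgebra.lift ℂ ℂ G ((Units.coeHom ℂ).comp τ)

/-- The pullback of Laurent polynomials on `T_G` to exponential sums with exponents in `G`. -/
def pullback (G : AddSubgroup (Module.Dual ℂ V)) : AddMonoidAlgebra ℂ G →ₐ[ℂ] ExpSum V :=
  AddMonoidAlgebra.mapDomainAlgHom ℂ ℂ G.subtype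

/-- The character `λ ↦ e^{λ(z)}` of the whole dual space. -/
def expChar (z : V) : Multiplicative (Module.Dual ℂ V) →* ℂ where
  toFun l := Complex.exp (l.toAdd z)
  map_one' := by simp
  map_mul' a b := by simp [Complex.exp_add]

/-- The value of an exponential sum at a point: `f(z) = ∑ c_λ e^{λ(z)}`. -/
def ExpSum.eval (f : ExpSum V) (z : V) : ℂ :=
  AddMonoidAlgebra.lift ℂ ℂ (Module.Dual ℂ V) (expChar z) f

theorem ExpSum.eval_eq (f : ExpSum V) (z : V) :
    f.eval z = f.coeff.sum fun l c => c * Complex.exp (l z) := by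
  simp [ExpSum.eval, AddMonoidAlgebra.lift_apply, expChar]

/-- The standard winding map `V → T_G`, sending `z` to the character `g ↦ e^{g(z)}`. -/
def winding (G : AddSubgroup (Module.Dual ℂ V)) (z : V) : Torus G where
  toFun g := Units.mk0 (Complex.exp ((g.toAdd : Module.Dual ℂ V) z)) (Complex.exp_ne_zero _)
  map_one' := by ext; simp
  map_mul' a b := by ext; simp [Complex.exp_add]

theorem eval_pullback (G : AddSubgroup (Module.Dual ℂ V)) (P : AddMonoidAlgebra ℂ G) (z : V) :
    (pullback G P).eval z = laurentEval (winding G z) P := by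
  have h : (AddMonoidAlgebra.lift ℂ ℂ (Module.Dual ℂ V) (expChar z)).comp (pullback G)
      = laurentEval (winding G z) := by
    apply AddMonoidAlgebra.algHom_ext'
    · ext g
      simp [pullback, laurentEval, winding, expChar]
    · exact Subsingleton.elim _ _
  exact DFunLike.congr_fun h P

/-- A set is an exponential hypersurface if it is the zero set of a single exponential sum which
does not vanish identically. -/
def IsExpHypersurface (D : Set V) : Prop :=
  ∃ f : ExpSum V, (∃ z, f.eval z ≠ 0) ∧ D = {z | f.eval z = 0}

/-- The algebraic variety in the torus `T_G` given by a system of Laurent polynomials. -/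
def torusVariety {G : AddSubgroup (Module.Dual ℂ V)} {ι : Type*} (P : ι → AddMonoidAlgebra ℂ G) :
    Set (Torus G) :=
  {τ | ∀ i, laurentEval τ (P i) = 0}

/-- The ideal of Laurent polynomials vanishing on a subset of the torus. -/
def vanishingIdeal {G : AddSubgroup (Module.Dual ℂ V)} (Z : Set (Torus G)) :
    Ideal (AddMonoidAlgebra ℂ G) :=
  ⨅ τ ∈ Z, RingHom.ker (laurentEval τ)

/-- The codimension of a subvariety of the torus: the height of its vanishing ideal, that is the
least codimension of an irreducible component. It is `⊤` for the empty set. -/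
def codim {G : AddSubgroup (Module.Dual ℂ V)} (Z : Set (Torus G)) : ℕ∞ :=
  (vanishingIdeal Z).height

/-- `Z` is the `G`-model of the exponential variety with equations `f i = 0`. Here `G` is a finitely
generated group of exponents that contains a basis of the dual space, and all `f i` have
exponents in `G`. -/
def IsModel {ι : Type*} (f : ι → ExpSum V) (G : AddSubgroup (Module.Dual ℂ V))
    (Z : Set (Torus G)) : Prop :=
  G.FG ∧ Submodule.span ℂ (G : Set (Module.Dual ℂ V)) = ⊤ ∧
    ∃ P : ι → AddMonoidAlgebra ℂ G, (∀ i, pullback G (P i) = f i) ∧ Z = torusVariety P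

/-- The exponential variety with equations `f i = 0` has algebraic codimension `k`: each of its
models has codimension `k`. -/
def HasAlgCodim {ι : Type*} (f : ι → ExpSum V) (k : ℕ) : Prop :=
  ∀ (G : AddSubgroup (Module.Dual ℂ V)) (Z : Set (Torus G)), IsModel f G Z → codim Z = (k : ℕ∞)

/-- The models of the exponential variety with equations `f i = 0` are empty. -/
def HasEmptyModel {ι : Type*} (f : ι → ExpSum V) : Prop :=
  ∀ (G : AddSubgroup (Module.Dual ℂ V)) (Z : Set (Torus G)), IsModel f G Z → Z = ∅

/-- Models exist, so that the two preceding definitions are not vacuous. -/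
theorem exists_isModel [FiniteDimensional ℂ V] {ι : Type*} [Finite ι] (f : ι → ExpSum V) :
    ∃ (G : AddSubgroup (Module.Dual ℂ V)) (Z : Set (Torus G)), IsModel f G Z := by
  classical
  obtain ⟨B, hB⟩ := (Module.Finite.fg_top : (⊤ : Submodule ℂ (Module.Dual ℂ V)).FG)
  let S : Set (Module.Dual ℂ V) := (B : Set _) ∪ ⋃ i, ((f i).coeff.support : Set _)
  have hS : S.Finite := B.finite_toSet.union (Set.finite_iUnion fun i => Finset.finite_toSet _)
  refine ⟨AddSubgroup.closure S, _, ⟨hS.toFinset, by simp⟩, ?_,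
    fun i => AddMonoidAlgebra.comapDomain Subtype.val Subtype.val_injective (f i), ?_, rfl⟩
  · rw [eq_top_iff, ← hB]
    exact Submodule.span_mono fun x hx => AddSubgroup.subset_closure (Or.inl hx)
  · intro i
    apply AddMonoidAlgebra.coeff_injective
    change Finsupp.mapDomain _ (Finsupp.comapDomain _ _ _) = _
    apply Finsupp.mapDomain_comapDomain _ Subtype.val_injective
    intro x hx
    exact ⟨⟨x, AddSubgroup.subset_closure (Or.inr (Set.mem_iUnion.2 ⟨i, hx⟩))⟩, rfl⟩

end Windings

/-- The coefficient vector of a system of exponential sums with `supp f i ⊆ Λ i`; these vectors are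
the linear coordinates on the space `S(Λ_1, …, Λ_k)` of such systems. -/
def coeffs {V : Type*} [AddCommGroup V] [Module ℂ V] {k : ℕ}
    (Λ : Fin k → Finset (Module.Dual ℂ V)) (f : Fin k → ExpSum V) :
    (Σ i : Fin k, {l // l ∈ Λ i}) → ℂ :=
  fun p => (f p.1).coeff p.2.1

end ExpGeom

end

/-!
The exponents of all the `Λ i` generate a finitely generated torsion-free group `G₀`, free of some
rank `m`. Everything is decided in its Laurent ring `A = ℂ[G₀]`.

Consider the incidence variety of the pairs (coefficients `c`, point `τ` of the torus of `G₀`) such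
that `τ` solves the system with coefficients `c`. Monomials do not vanish on the torus, so equation
`i` can be solved for the coefficient of one chosen exponent of `Λ i`. Hence the incidence variety is
the product of the torus with an affine space, of dimension `|σ| - k + m`, where `|σ|` is the number
of coefficients. Let `φ` be the homomorphism of coordinate rings that corresponds to its projection
to the space of coefficients (`incidenceMap`).

If `φ` is not injective, a nonzero polynomial in its kernel vanishes at all `c` for which the system
has a solution; this gives the alternative of empty models. If `φ` is injective, the system has a
solution for generic `c` by Chevalley's theorem (`MvPolynomial.exists_ne_zero_forall_exists_algHom`).
Moreover the coefficients together with any `m + 1 - k` coordinates of the torus are algebraically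
dependent on the incidence variety, since there are more of them than its dimension. A nonzero
coefficient of such a relation, as a polynomial in the coordinates, is a polynomial in `c`; where it
does not vanish, these coordinates are dependent on every component of the solution set
(`exists_ne_zero_forall_not_algebraicIndependent`). So all components have transcendence degree at
most `m - k`, and by the inequality `m ≤ height + transcendence degree` for primes of polynomial
rings (`MvPolynomial.le_height_add_trdeg`) they have height at least `k`. No theorem on the dimension
of fibres is needed. The two cases are combined in `exists_resultant`.

For a larger group `G` the Laurent ring is free over `A` (`faithfullyFlat_mapDomainAlgHom`):
the ideal of the system stays proper, and heights do not drop, by going down. Krull's height theorem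
and the Nullstellensatz give the opposite inequality for the codimension
(`ExpGeom.codim_torusVariety_eq`).
-/

/-! ### Rational points and Chevalley's theorem -/

/-- The weak Nullstellensatz: over an algebraically closed field, every maximal ideal of an algebra
of finite type is the kernel of a rational point. -/
theorem Ideal.IsMaximal.exists_algHom_ker_eq {K B : Type*} [Field K] [IsAlgClosed K] [CommRing B]
    [Algebra K B] [Algebra.FiniteType K B] (M : Ideal B) [M.IsMaximal] :
    ∃ ψ : B →ₐ[K] K, RingHom.ker ψ = M := by
  let _ := Ideal.Quotient.field M
  have : Module.Finite K (B ⧸ M) := finite_of_finite_type_of_isJacobsonRing K (B ⧸ M)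
  let e : (B ⧸ M) ≃ₐ[K] K := (AlgEquiv.ofBijective (Algebra.ofId K (B ⧸ M))
    IsAlgClosed.algebraMap_bijective_of_isIntegral).symm
  refine ⟨(e : (B ⧸ M) →ₐ[K] K).comp (Ideal.Quotient.mkₐ K M), ?_⟩
  ext x
  simp [RingHom.mem_ker, Ideal.Quotient.eq_zero_iff_mem]

open MvPolynomial in
/-- A dominant morphism of finite type from an irreducible variety to an affine space has a rational
point over every point outside some hypersurface. By Chevalley's theorem its image is constructible,
and a constructible set that contains the generic point contains a basic open set. -/
theorem MvPolynomial.exists_ne_zero_forall_exists_algHom {K σ B : Type*} [Field K] [IsAlgClosed K]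
    [Finite σ] [CommRing B] [IsDomain B] [Algebra K B] [Algebra.FiniteType K B]
    (φ : MvPolynomial σ K →ₐ[K] B) (hφ : Function.Injective φ) :
    ∃ r : MvPolynomial σ K, r ≠ 0 ∧ ∀ c : σ → K, eval c r ≠ 0 →
      ∃ ψ : B →ₐ[K] K, ∀ q, ψ (φ q) = eval c q := by
  have hft : φ.toRingHom.FiniteType := by
    apply RingHom.FiniteType.of_comp_finiteType (f := algebraMap K (MvPolynomial σ K))
    rw [AlgHom.toRingHom_eq_coe, AlgHom.comp_algebraMap]
    exact (RingHom.finiteType_algebraMap (A := K) (B := B)).2 inferInstance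
  have hfp : φ.toRingHom.FinitePresentation := RingHom.FinitePresentation.of_finiteType.1 hft
  obtain ⟨S, hS⟩ := PrimeSpectrum.exists_constructibleSetData_iff.2
    (PrimeSpectrum.isConstructible_range_comap hfp)
  -- `φ` is injective, so the generic point is the image of the generic point of `Spec B`.
  have hgen : (⊥ : PrimeSpectrum (MvPolynomial σ K)) ∈ S.toSet := by
    rw [hS]
    refine ⟨⊥, ?_⟩
    ext x
    simpa using map_eq_zero_iff φ hφ
  simp only [PrimeSpectrum.ConstructibleSetData.toSet, Set.mem_iUnion] at hgen
  obtain ⟨C, hC, hCg, hCf⟩ := hgen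
  have hg : ∀ i, C.g i = 0 := fun i => hCg (Set.mem_range_self i)
  refine ⟨C.f, fun h => hCf (by simp [h]), fun c hc => ?_⟩
  let m : PrimeSpectrum (MvPolynomial σ K) := ⟨RingHom.ker (eval c), RingHom.ker_isPrime _⟩
  have hm : m ∈ Set.range (PrimeSpectrum.comap φ.toRingHom) := by
    rw [← hS]
    refine Set.mem_biUnion hC ⟨?_, ?_⟩
    · rintro _ ⟨i, rfl⟩
      simp [hg i]
    · simpa [PrimeSpectrum.mem_zeroLocus, m] using hc
  obtain ⟨P, hP⟩ := hm
  obtain ⟨M, hM, hPM⟩ := P.asIdeal.exists_le_maximal P.2.ne_top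
  obtain ⟨ψ, hψ⟩ := Ideal.IsMaximal.exists_algHom_ker_eq (K := K) M
  refine ⟨ψ, fun q => ?_⟩
  have hmem : φ (q - MvPolynomial.C (eval c q)) ∈ P.asIdeal := by
    have : q - MvPolynomial.C (eval c q) ∈ m.asIdeal := by simp [m]
    rw [← hP] at this
    exact this
  have h0 : ψ (φ (q - MvPolynomial.C (eval c q))) = 0 := by
    rw [← RingHom.mem_ker, hψ]
    exact hPM hmem
  have hCc : φ (MvPolynomial.C (eval c q)) = algebraMap K B (eval c q) := by
    rw [← MvPolynomial.algebraMap_eq, AlgHom.commutes]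
  rw [map_sub, map_sub, sub_eq_zero, hCc, AlgHom.commutes] at h0
  simpa using h0

/-! ### Heights of primes in polynomial rings -/

/-- In a polynomial ring `R[X]` a prime that is not extended from `R` has larger height than its
contraction. -/
theorem Polynomial.height_under_add_one_le {R : Type*} [CommRing R] [IsNoetherianRing R]
    (P : Ideal (Polynomial R)) [P.IsPrime] (h : (P.under R).map Polynomial.C ≠ P) :
    (P.under R).height + 1 ≤ P.height := by
  have hp := Ideal.height_eq_height_add_of_liesOver_of_hasGoingDown (P.under R) P
  have hprime : ((P.under R).map Polynomial.C).IsPrime := Ideal.isPrime_map_C_of_isPrime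
  rw [hp]
  gcongr
  rw [Order.one_le_iff_pos, pos_iff_ne_zero]
  have : IsDomain (Polynomial R ⧸ (P.under R).map (algebraMap R (Polynomial R))) :=
    (Ideal.Quotient.isDomain_iff_prime _).2 hprime
  rw [Ne, Ideal.height_eq_zero_iff_eq_bot, Ideal.map_eq_bot_iff_le_ker, Ideal.mk_ker]
  intro hle
  exact h (le_antisymm (Ideal.map_le_iff_le_comap.2 le_rfl) hle)

theorem Ideal.height_under_le {R S : Type*} [CommRing R] [CommRing S] [IsNoetherianRing R]
    [IsNoetherianRing S] [Algebra R S] [Algebra.HasGoingDown R S] (P : Ideal S) [P.IsPrime] :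
    (P.under R).height ≤ P.height := by
  rw [Ideal.height_eq_height_add_of_liesOver_of_hasGoingDown (P.under R) P]
  exact le_self_add

open Algebra in
/-- The step from `R` to `R[X]` in `MvPolynomial.le_height_add_trdeg`. A prime `P` over `p` either is
`p R[X]`, and then the residue ring gains a variable, or is strictly larger, and then the height
grows. -/
theorem Polynomial.add_one_le_height_add_trdeg {K R : Type*} [Field K] [CommRing R] [Algebra K R]
    [IsNoetherianRing R] {m : ℕ}
    (hR : ∀ p : Ideal R, p.IsPrime → (m : ℕ∞) ≤ p.height + Cardinal.toENat (trdeg K (R ⧸ p)))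
    (P : Ideal (Polynomial R)) [hP : P.IsPrime] :
    ((m + 1 : ℕ) : ℕ∞) ≤ P.height + Cardinal.toENat (trdeg K (Polynomial R ⧸ P)) := by
  have hm := hR (P.under R) inferInstance
  push_cast
  by_cases h : (P.under R).map Polynomial.C = P
  · have hdom : IsDomain (R ⧸ P.under R) := Ideal.Quotient.isDomain _
    let e : Polynomial (R ⧸ P.under R) ≃ₐ[K] (Polynomial R ⧸ P) :=
      AlgEquiv.ofRingEquiv (f := (Ideal.polynomialQuotientEquivQuotientPolynomial (P.under R)).trans
        (Ideal.quotEquivOfEq h)) (fun r => by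
          have : algebraMap K (Polynomial (R ⧸ P.under R)) r
            = (Polynomial.C (algebraMap K R r)).map (Ideal.Quotient.mk (P.under R)) := by
            rw [Polynomial.map_C]
            rfl
          rw [this, RingEquiv.trans_apply, Ideal.polynomialQuotientEquivQuotientPolynomial_map_mk]
          rfl)
    have h1 : trdeg K (Polynomial R ⧸ P) = trdeg K (R ⧸ P.under R) + 1 := by
      rw [← e.trdeg_eq, ← Polynomial.trdeg_of_isDomain (R := R ⧸ P.under R)]
      have : FaithfulSMul K (R ⧸ P.under R) := inferInstance
      exact (trdeg_add_eq K (R ⧸ P.under R) (A := Polynomial (R ⧸ P.under R))).symm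
    rw [h1, map_add, map_one, ← add_assoc]
    gcongr
    exact hm.trans (by gcongr; exact Ideal.height_under_le P)
  · have h2 : trdeg K (R ⧸ P.under R) ≤ trdeg K (Polynomial R ⧸ P) :=
      trdeg_le_of_injective (Ideal.quotientMapₐ P (Polynomial.CAlgHom (R := K) (A := R)) le_rfl)
        (Ideal.quotientMap_injective (I := P) (f := Polynomial.C))
    calc ((m : ℕ∞) + 1) ≤ (P.under R).height + Cardinal.toENat (trdeg K (R ⧸ P.under R)) + 1 := by
          gcongr
      _ = ((P.under R).height + 1) + Cardinal.toENat (trdeg K (R ⧸ P.under R)) := by ring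
      _ ≤ _ := by
          gcongr
          exact Polynomial.height_under_add_one_le P h

open Algebra in
/-- The inequality `dim ≤ height + coheight` for polynomial rings over a field, with the
coheight of a prime measured by the transcendence degree of its residue ring. -/
theorem MvPolynomial.le_height_add_trdeg {K : Type*} [Field K] (m : ℕ)
    (P : Ideal (MvPolynomial (Fin m) K)) [hP : P.IsPrime] :
    (m : ℕ∞) ≤ P.height + Cardinal.toENat (trdeg K (MvPolynomial (Fin m) K ⧸ P)) := by
  induction m with
  | zero => simp
  | succ m ih =>
    let e := (MvPolynomial.finSuccEquiv K m).symm
    have h := Polynomial.add_one_le_height_add_trdeg (K := K) (m := m) (fun p hp => @ih p hp)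
      (P.comap e)
    have h1 : (P.comap e).height = P.height := e.toRingEquiv.height_comap P
    have e2 : (Polynomial (MvPolynomial (Fin m) K) ⧸ P.comap e) ≃ₐ[K]
      (MvPolynomial (Fin (m + 1)) K ⧸ P) := Ideal.quotientEquivAlg _ _ e
        (Ideal.map_comap_of_surjective _ e.surjective P).symm
    rw [h1, e2.trdeg_eq] at h
    exact h

/-! ### Laurent polynomial rings -/

section GroupAlgebra

open Algebra

variable {K G : Type*} [Field K] [AddCommGroup G] {m : ℕ}

/-- The inclusion into the Laurent ring `K[G]` of the polynomial ring in the variables given by a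
basis of `G`. -/
noncomputable def laurentVars (K : Type*) [Field K] (b : Module.Basis (Fin m) ℤ G) :
    MvPolynomial (Fin m) K →ₐ[K] AddMonoidAlgebra K G :=
  AddMonoidAlgebra.mapDomainAlgHom K K
    ((b.repr.symm : (Fin m →₀ ℤ) →+ G).comp
      (Finsupp.mapRange.addMonoidHom (Nat.castAddMonoidHom ℤ)))

theorem laurentVars_monomial (b : Module.Basis (Fin m) ℤ G) (a : Fin m →₀ ℕ) (c : K) :
    laurentVars K b (MvPolynomial.monomial a c)
      = AddMonoidAlgebra.single (b.repr.symm (a.mapRange (fun n : ℕ => (n : ℤ)) rfl)) c :=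
  AddMonoidAlgebra.mapDomain_single

theorem laurentVars_X (b : Module.Basis (Fin m) ℤ G) (i : Fin m) :
    laurentVars K b (MvPolynomial.X i) = AddMonoidAlgebra.single (b i) 1 := by
  rw [MvPolynomial.X, laurentVars_monomial]
  simp

theorem laurentVars_injective (b : Module.Basis (Fin m) ℤ G) :
    Function.Injective (laurentVars K b) := by
  apply AddMonoidAlgebra.mapDomain_injective
  apply b.repr.symm.injective.comp
  exact Finsupp.mapRange_injective _ rfl Nat.cast_injective

/-- Laurent polynomials become polynomials after multiplication by a monomial. The submonoid to be
inverted is that of all polynomials which become units. -/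
theorem isLocalization_laurentVars (b : Module.Basis (Fin m) ℤ G) :
    letI := (laurentVars K b).toAlgebra
    IsLocalization ((IsUnit.submonoid (AddMonoidAlgebra K G)).comap (laurentVars K b))
      (AddMonoidAlgebra K G) := by
  let _ := (laurentVars K b).toAlgebra
  refine ⟨fun y => y.2, fun z => ?_, fun {x y} h => ⟨1, ?_⟩⟩
  · induction z using AddMonoidAlgebra.induction_linear with
    | zero => exact ⟨(0, 1), by simp⟩
    | add f g hf hg =>
      obtain ⟨⟨p, s⟩, h1⟩ := hf
      obtain ⟨⟨q, t⟩, h2⟩ := hg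
      refine ⟨(p * t + q * s, s * t), ?_⟩
      simp only [Submonoid.coe_mul, map_mul, map_add] at h1 h2 ⊢
      linear_combination (algebraMap _ (AddMonoidAlgebra K G) (t : MvPolynomial (Fin m) K)) * h1 +
        (algebraMap _ (AddMonoidAlgebra K G) (s : MvPolynomial (Fin m) K)) * h2
    | single g c =>
      let pos : Fin m →₀ ℕ := (b.repr g).mapRange Int.toNat rfl
      let neg : Fin m →₀ ℕ := (-b.repr g).mapRange Int.toNat rfl
      have hneg : IsUnit (laurentVars K b (MvPolynomial.monomial neg 1)) := by
        rw [laurentVars_monomial]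
        refine IsUnit.of_mul_eq_one (AddMonoidAlgebra.single
          (-b.repr.symm (neg.mapRange (fun n : ℕ => (n : ℤ)) rfl)) 1) ?_
        rw [AddMonoidAlgebra.single_mul_single, add_neg_cancel, mul_one]
        rfl
      refine ⟨(MvPolynomial.monomial pos c, ⟨MvPolynomial.monomial neg 1, hneg⟩), ?_⟩
      have hmul : AddMonoidAlgebra.single g c * laurentVars K b (MvPolynomial.monomial neg 1)
          = laurentVars K b (MvPolynomial.monomial pos c) := by
        rw [laurentVars_monomial, laurentVars_monomial, AddMonoidAlgebra.single_mul_single, mul_one]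
        congr 1
        apply b.repr.injective
        ext i
        simp [pos, neg]
        omega
      exact hmul
  · rw [laurentVars_injective b h]

theorem trdeg_addMonoidAlgebra [IsDomain (AddMonoidAlgebra K G)] (b : Module.Basis (Fin m) ℤ G) :
    trdeg K (AddMonoidAlgebra K G) = m := by
  let _ := (laurentVars K b).toAlgebra
  have : IsScalarTower K (MvPolynomial (Fin m) K) (AddMonoidAlgebra K G) :=
    IsScalarTower.of_algebraMap_eq fun x => ((laurentVars K b).commutes x).symm
  have := isLocalization_laurentVars (K := K) b
  have : FaithfulSMul (MvPolynomial (Fin m) K) (AddMonoidAlgebra K G) :=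
    (faithfulSMul_iff_algebraMap_injective _ _).2 (laurentVars_injective b)
  have : Algebra.IsAlgebraic (MvPolynomial (Fin m) K) (AddMonoidAlgebra K G) :=
    IsLocalization.isAlgebraic _ ((IsUnit.submonoid (AddMonoidAlgebra K G)).comap (laurentVars K b))
  have h := lift_trdeg_add_eq K (MvPolynomial (Fin m) K) (AddMonoidAlgebra K G)
  rw [trdeg_eq_zero (R := MvPolynomial (Fin m) K), MvPolynomial.trdeg_of_isDomain] at h
  simpa using h.symm

/-- A prime of the Laurent ring has height at least `k` as soon as its coordinate functions have no
`m + 1 - k` algebraically independent members on the corresponding subvariety. -/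
theorem le_height_of_not_algebraicIndependent [AddMonoid.FG G] [IsDomain (AddMonoidAlgebra K G)]
    (b : Module.Basis (Fin m) ℤ G) (k : ℕ) (p : Ideal (AddMonoidAlgebra K G)) [p.IsPrime]
    (h : ∀ f : Fin (m + 1 - k) → Fin m, ¬ AlgebraicIndependent K
      (fun j => Ideal.Quotient.mkₐ K p (AddMonoidAlgebra.single (b (f j)) 1))) :
    (k : ℕ∞) ≤ p.height := by
  let _ := (laurentVars K b).toAlgebra
  have := isLocalization_laurentVars (K := K) b
  have : IsScalarTower K (MvPolynomial (Fin m) K) (AddMonoidAlgebra K G) :=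
    IsScalarTower.of_algebraMap_eq fun x => ((laurentVars K b).commutes x).symm
  rw [← IsLocalization.height_under
    ((IsUnit.submonoid (AddMonoidAlgebra K G)).comap (laurentVars K b)) p]
  set q := p.under (MvPolynomial (Fin m) K) with hq
  have hD := MvPolynomial.le_height_add_trdeg m q
  let ι : (MvPolynomial (Fin m) K ⧸ q) →ₐ[K] (AddMonoidAlgebra K G ⧸ p) :=
    Ideal.quotientMapₐ p (laurentVars K b) le_rfl
  have hι : Function.Injective ι := Ideal.quotientMap_injective
  let x : Fin m → MvPolynomial (Fin m) K ⧸ q := fun i => Ideal.Quotient.mkₐ K q (MvPolynomial.X i)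
  have hx : ∀ i, ι (x i) = Ideal.Quotient.mkₐ K p (AddMonoidAlgebra.single (b i) 1) := by
    intro i
    rw [← laurentVars_X]
    rfl
  have hadj : adjoin K (Set.range x) = ⊤ := by
    have : Set.range x = Ideal.Quotient.mkₐ K q '' Set.range MvPolynomial.X := by
      rw [← Set.range_comp]; rfl
    rw [this, ← AlgHom.map_adjoin, MvPolynomial.adjoin_range_X, Algebra.map_top,
      AlgHom.range_eq_top]
    exact Ideal.Quotient.mkₐ_surjective K q
  have : Algebra.IsAlgebraic (adjoin K (Set.range x)) (MvPolynomial (Fin m) K ⧸ q) := by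
    rw [hadj]
    exact ⟨fun y => isAlgebraic_algebraMap (⟨y, mem_top⟩ : (⊤ : Subalgebra K _))⟩
  -- The coordinates generate the residue ring, so they contain a transcendence basis.
  obtain ⟨t, htx, ht⟩ := exists_isTranscendenceBasis_subset (R := K) (Set.range x)
  have htf : t.Finite := (Set.finite_range x).subset htx
  have := htf.fintype
  rw [← ht.cardinalMk_eq_trdeg, Cardinal.mk_fintype, map_natCast] at hD
  have hlt : Fintype.card t < m + 1 - k := by
    by_contra! hle
    choose f hf using fun y : t => htx y.2
    let g : Fin (m + 1 - k) ↪ t := (Fin.castLEEmb hle).trans (Fintype.equivFin t).symm.toEmbedding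
    refine h (f ∘ g) ?_
    have h1 := (ht.1.comp g g.injective).map' hι
    convert h1 using 2 with j
    simp [← hx, hf]
  have hD' : (m : ℕ∞) ≤ q.height + (Fintype.card t : ℕ) := hD
  by_cases hk : q.height = ⊤
  · simp [hk]
  · lift q.height to ℕ using hk with d
    norm_cast at hD' ⊢
    omega

/-- The Laurent ring of a group is free, with the cosets as a basis, over that of a subgroup. -/
theorem faithfullyFlat_mapDomainAlgHom {H : Type*} [AddCommGroup H] (f : H →+ G)
    (hf : Function.Injective f) :
    letI := (AddMonoidAlgebra.mapDomainAlgHom K K f).toAlgebra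
    Module.FaithfullyFlat (AddMonoidAlgebra K H) (AddMonoidAlgebra K G) := by
  classical
  let _ := (AddMonoidAlgebra.mapDomainAlgHom K K f).toAlgebra
  have hsmul : ∀ (a : AddMonoidAlgebra K H) (x : AddMonoidAlgebra K G),
    a • x = AddMonoidAlgebra.mapDomain f a * x := fun a x => rfl
  let v : (G ⧸ f.range) → AddMonoidAlgebra K G := fun q => AddMonoidAlgebra.single q.out 1
  have hli : LinearIndependent (AddMonoidAlgebra K H) v := by
    rw [linearIndependent_iff']
    intro s a hs q hq
    ext h
    have h1 := congrArg (fun z : AddMonoidAlgebra K G => z.coeff (f h + q.out)) hs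
    simp only [AddMonoidAlgebra.coeff_sum, hsmul, v, Finset.sum_apply', AddMonoidAlgebra.coeff_zero,
      Finsupp.coe_zero, Pi.zero_apply, AddMonoidAlgebra.coeff_mul_single_apply, mul_one] at h1
    rw [Finset.sum_eq_single_of_mem q hq] at h1
    · have : f h + q.out - q.out = f h := by abel
      rw [← sub_eq_add_neg, this] at h1
      exact (Finsupp.mapDomain_apply hf (a q).coeff h).symm.trans h1
    · intro r hr hrq
      refine Finsupp.mapDomain_of_notMem_range _ _ ?_
      rintro ⟨h', hh'⟩
      apply hrq
      rw [← QuotientAddGroup.out_eq' r, ← QuotientAddGroup.out_eq' q, QuotientAddGroup.eq]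
      refine ⟨h' - h, ?_⟩
      rw [map_sub, hh']
      abel
  have hsp : ⊤ ≤ Submodule.span (AddMonoidAlgebra K H) (Set.range v) := by
    rintro x -
    induction x using AddMonoidAlgebra.induction_linear with
    | zero => exact zero_mem _
    | add x y hx hy => exact add_mem hx hy
    | single g c =>
      obtain ⟨h, hh⟩ : ∃ h, f h + (QuotientAddGroup.mk g : G ⧸ f.range).out = g := by
        obtain ⟨⟨_, h, rfl⟩, hh⟩ := QuotientAddGroup.mk_out_eq_add f.range g
        exact ⟨-h, by rw [hh, map_neg]; abel⟩
      have : AddMonoidAlgebra.single g c = (AddMonoidAlgebra.single h c : AddMonoidAlgebra K H) •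
          v (QuotientAddGroup.mk g) := by
        rw [hsmul, AddMonoidAlgebra.mapDomain_single, AddMonoidAlgebra.single_mul_single, hh,
          mul_one]
      rw [this]
      exact Submodule.smul_mem _ _ (Submodule.subset_span (Set.mem_range_self _))
  have := Module.Free.of_basis (Module.Basis.mk hli hsp)
  infer_instance

end GroupAlgebra

/-! ### Generic systems of equations -/

section GenericSystem

open Algebra

universe u

variable {K A ι : Type u} [Field K] [CommRing A] [Algebra K A] {L : ι → Type u}
  [∀ i, Fintype (L i)]

/-- The system of functions `∑ₗ c (i, l) u (i, l)`: linear in the coefficients `c (i, l)`, with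
the units `u (i, l)` in the role of monomials. -/
def linearSystem (u : ∀ i, L i → Aˣ) (c : (Σ i, L i) → K) (i : ι) : A :=
  ∑ l, c ⟨i, l⟩ • (u i l : A)

open Classical in
/-- The projection of the incidence variety `{(c, τ) | τ solves the system with coefficients c}` to
the space of coefficients, as a map of coordinate rings. Equation `i` expresses the coefficient of
the distinguished unit `u i (l₀ i)` through `τ` and the other coefficients, so the incidence
variety is the product of `Spec A` with the space of the other coefficients. -/
noncomputable def incidenceMap (K : Type u) [Field K] [Algebra K A] (u : ∀ i, L i → Aˣ)
    (l₀ : ∀ i, L i) :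
    MvPolynomial (Σ i, L i) K →ₐ[K] MvPolynomial {p : Σ i, L i // p.2 ≠ l₀ p.1} A :=
  MvPolynomial.aeval fun p =>
    if h : p.2 = l₀ p.1 then
      -∑ l : {l : L p.1 // l ≠ l₀ p.1}, MvPolynomial.X ⟨⟨p.1, l⟩, l.2⟩ *
        MvPolynomial.C (u p.1 l * ((u p.1 (l₀ p.1))⁻¹ : Aˣ) : A)
    else MvPolynomial.X ⟨p, h⟩

variable (u : ∀ i, L i → Aˣ) (l₀ : ∀ i, L i)

theorem incidenceMap_X_of_ne (p : {p : Σ i, L i // p.2 ≠ l₀ p.1}) :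
    incidenceMap K u l₀ (MvPolynomial.X p.1) = MvPolynomial.X p := by
  simp [incidenceMap, p.2]

/-- The equations of the system hold on the incidence variety. -/
theorem sum_incidenceMap_X_mul (i : ι) :
    ∑ l, incidenceMap K u l₀ (MvPolynomial.X ⟨i, l⟩) * MvPolynomial.C (u i l : A) = 0 := by
  classical
  rw [Fintype.sum_eq_add_sum_subtype_ne _ (l₀ i)]
  have h1 : incidenceMap K u l₀ (MvPolynomial.X ⟨i, l₀ i⟩) =
      -∑ l : {l : L i // l ≠ l₀ i}, MvPolynomial.X ⟨⟨i, l⟩, l.2⟩ *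
        MvPolynomial.C (u i l * ((u i (l₀ i))⁻¹ : Aˣ) : A) := by
    simp [incidenceMap]
  rw [h1, neg_mul, Finset.sum_mul, neg_add_eq_zero]
  refine Finset.sum_congr rfl fun l _ => ?_
  rw [incidenceMap_X_of_ne u l₀ ⟨⟨i, l⟩, l.2⟩, mul_assoc, ← MvPolynomial.C_mul,
    Units.inv_mul_cancel_right]

/-- A point of the incidence variety over `c` is a solution of the system with coefficients `c`. -/
theorem map_linearSystem_eq_zero {D : Type*} [CommRing D] [Algebra K D] (c : (Σ i, L i) → K)
    (ψ : MvPolynomial {p : Σ i, L i // p.2 ≠ l₀ p.1} A →ₐ[K] D)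
    (hψ : ∀ q, ψ (incidenceMap K u l₀ q) = algebraMap K D (MvPolynomial.eval c q)) (i : ι) :
    ψ (MvPolynomial.C (linearSystem u c i)) = 0 := by
  have h := congrArg ψ (sum_incidenceMap_X_mul (K := K) u l₀ i)
  rw [map_sum, map_zero] at h
  rw [← h, linearSystem, map_sum, map_sum]
  refine Finset.sum_congr rfl fun l _ => ?_
  rw [map_mul, hψ, MvPolynomial.eval_X, ← Algebra.smul_def, ← map_smul, ← MvPolynomial.algebraMap_eq,
    ← IsScalarTower.coe_toAlgHom' K A, map_smul]

/-- A solution, with values in any algebra, of the system with coefficients `c` is a point of the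
incidence variety over `c`. -/
theorem exists_algHom_incidenceMap {D : Type*} [CommRing D] [Algebra K D] (c : (Σ i, L i) → K)
    (τ : A →ₐ[K] D) (hτ : ∀ i, τ (linearSystem u c i) = 0) :
    ∃ ψ : MvPolynomial {p : Σ i, L i // p.2 ≠ l₀ p.1} A →ₐ[K] D,
      (∀ a, ψ (MvPolynomial.C a) = τ a) ∧
      ∀ q, ψ (incidenceMap K u l₀ q) = algebraMap K D (MvPolynomial.eval c q) := by
  classical
  let ψ : MvPolynomial {p : Σ i, L i // p.2 ≠ l₀ p.1} A →ₐ[K] D :=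
    { MvPolynomial.eval₂Hom (τ : A →+* D) (fun p => algebraMap K D (c p.1)) with
      commutes' := fun r => by
        change MvPolynomial.eval₂ _ _ (MvPolynomial.C (algebraMap K A r)) = _
        rw [MvPolynomial.eval₂_C]
        exact τ.commutes r }
  have hC : ∀ a, ψ (MvPolynomial.C a) = τ a := fun a => MvPolynomial.eval₂_C _ _ _
  have hX : ∀ p, ψ (MvPolynomial.X p) = algebraMap K D (c p.1) := fun p =>
    MvPolynomial.eval₂_X _ _ _
  refine ⟨ψ, hC, fun q => ?_⟩
  suffices h : ψ.comp (incidenceMap K u l₀) = (Algebra.ofId K D).comp (MvPolynomial.aeval c) by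
    have := DFunLike.congr_fun h q
    simpa [MvPolynomial.aeval_eq_eval] using this
  apply MvPolynomial.algHom_ext
  rintro ⟨i, l⟩
  simp only [AlgHom.comp_apply, MvPolynomial.aeval_X, Algebra.ofId_apply]
  by_cases hl : l = l₀ i
  · -- Equation `i` determines the coefficient of the unit `u i (l₀ i)` from the others.
    subst hl
    have h1 := congrArg ψ (sum_incidenceMap_X_mul (K := K) u l₀ i)
    have h2 := hτ i
    rw [linearSystem, map_sum, Fintype.sum_eq_add_sum_subtype_ne _ (l₀ i)] at h2
    rw [map_zero, map_sum, Fintype.sum_eq_add_sum_subtype_ne _ (l₀ i), ← h2] at h1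
    have hu : IsUnit (τ (u i (l₀ i))) := (u i (l₀ i)).isUnit.map τ
    have h3 : ∀ l : {l : L i // l ≠ l₀ i},
        ψ (incidenceMap K u l₀ (MvPolynomial.X ⟨i, l⟩) * MvPolynomial.C (u i l : A))
        = τ (c ⟨i, l⟩ • (u i l : A)) := by
      intro l
      rw [incidenceMap_X_of_ne u l₀ ⟨⟨i, l⟩, l.2⟩, map_mul, hX, hC, map_smul, Algebra.smul_def]
    rw [Finset.sum_congr rfl fun l _ => h3 l, add_left_inj, map_mul, hC, map_smul,
      Algebra.smul_def] at h1
    exact hu.mul_right_cancel h1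
  · rw [incidenceMap_X_of_ne u l₀ ⟨⟨i, l⟩, hl⟩, hX]

theorem card_ne_add_card {ι : Type*} {L : ι → Type*} [Finite ι] [∀ i, Finite (L i)]
    (l₀ : ∀ i, L i) :
    Nat.card {p : Σ i, L i // p.2 ≠ l₀ p.1} + Nat.card ι = Nat.card (Σ i, L i) := by
  classical
  have e1 : {p : Σ i, L i // p.2 = l₀ p.1} ≃ ι :=
    { toFun := fun p => p.1.1
      invFun := fun i => ⟨⟨i, l₀ i⟩, rfl⟩
      left_inv := by
        rintro ⟨⟨i, l⟩, h⟩
        simp only at h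
        subst h
        rfl
      right_inv := fun i => rfl }
  rw [← Nat.card_congr e1, add_comm, ← Nat.card_sum]
  exact Nat.card_congr (Equiv.sumCompl (fun p : Σ i, L i => p.2 = l₀ p.1))

/-- The incidence variety has dimension `|σ| - k + m`, where `|σ|` is the number of coefficients and
`m` the dimension of `Spec A`, so the coefficients and more than `m - k` functions on `Spec A` are
dependent on it. -/
theorem not_algebraicIndependent_incidenceMap [Finite ι] [IsDomain A] {m : ℕ} (hm : trdeg K A = m)
    (x : Fin (m + 1 - Nat.card ι) → A) :
    ¬ AlgebraicIndependent K (Sum.elim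
      (fun j => MvPolynomial.C (x j) : _ → MvPolynomial {p : Σ i, L i // p.2 ≠ l₀ p.1} A)
      (fun p => incidenceMap K u l₀ (MvPolynomial.X p))) := by
  intro h
  have h1 := h.lift_cardinalMk_le_trdeg
  have h2 := trdeg_add_eq K A (A := MvPolynomial {p : Σ i, L i // p.2 ≠ l₀ p.1} A)
  rw [hm, MvPolynomial.trdeg_of_isDomain] at h2
  rw [← h2] at h1
  have h3 := card_ne_add_card l₀
  rw [Cardinal.lift_id, Cardinal.lift_id, Cardinal.lift_id, Cardinal.mk_sum, Cardinal.mk_fin,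
    ← Nat.cast_card, ← Nat.cast_card, ← h3] at h1
  simp only [Cardinal.lift_natCast] at h1
  norm_cast at h1
  omega

/-- Outside a hypersurface in the space of coefficients, the solution set of the system has
dimension at most `m - k`: more than `m - k` functions satisfy on it an algebraic relation, which
is the specialization of a relation on the incidence variety. -/
theorem exists_ne_zero_forall_not_algebraicIndependent [∀ i, Nonempty (L i)] [Finite ι]
    [IsDomain A] {m : ℕ} (hm : trdeg K A = m) (x : Fin (m + 1 - Nat.card ι) → A) :
    ∃ r : MvPolynomial (Σ i, L i) K, r ≠ 0 ∧ ∀ c, MvPolynomial.eval c r ≠ 0 →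
      ∀ (D : Type u) [CommRing D] [Algebra K D] (τ : A →ₐ[K] D),
        (∀ i, τ (linearSystem u c i) = 0) → ¬ AlgebraicIndependent K (fun j => τ (x j)) := by
  let l₀ : ∀ i, L i := fun i => Classical.arbitrary (L i)
  have h := not_algebraicIndependent_incidenceMap (K := K) u l₀ hm x
  rw [algebraicIndependent_iff] at h
  push Not at h
  obtain ⟨F, hF, hF0⟩ := h
  let F' := MvPolynomial.sumAlgEquiv K _ _ F
  have hF' : F' ≠ 0 := by simpa [F'] using hF0
  -- The relation `F` stays nontrivial where one of its coefficients, as a polynomial in the `x j`,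
  -- does not vanish.
  obtain ⟨d, hd⟩ := MvPolynomial.ne_zero_iff.1 hF'
  refine ⟨F'.coeff d, hd, fun c hc D _ _ τ hτ hind => ?_⟩
  obtain ⟨ψ, hψC, hψ⟩ := exists_algHom_incidenceMap u l₀ c τ hτ
  have hne : MvPolynomial.map (MvPolynomial.eval c) F' ≠ 0 := by
    rw [MvPolynomial.ne_zero_iff]
    exact ⟨d, by rwa [MvPolynomial.coeff_map]⟩
  apply hne
  apply algebraicIndependent_iff.1 hind
  rw [← map_zero ψ, ← hF]
  have hcomp : ((MvPolynomial.aeval fun j => τ (x j)).comp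
      ((MvPolynomial.mapAlgHom (MvPolynomial.aeval c)).comp
        (MvPolynomial.sumAlgEquiv K _ _).toAlgHom)) =
      ψ.comp (MvPolynomial.aeval (Sum.elim
        (fun j => MvPolynomial.C (x j) : _ → MvPolynomial {p : Σ i, L i // p.2 ≠ l₀ p.1} A)
        (fun p => incidenceMap K u l₀ (MvPolynomial.X p)))) := by
    apply MvPolynomial.algHom_ext
    rintro (j | p)
    · simp [hψC]
    · simp [hψ]
  exact DFunLike.congr_fun hcomp F

/-- A generic system of `k` equations in the Laurent ring of rank `m` either has no solutions, or
has solutions and all components of its solution set have codimension at least `k`. -/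
theorem exists_resultant [IsAlgClosed K] [∀ i, Nonempty (L i)] [Finite ι] {G : Type u}
    [AddCommGroup G] [AddMonoid.FG G] [IsDomain (AddMonoidAlgebra K G)] {m : ℕ}
    (b : Module.Basis (Fin m) ℤ G) (u : ∀ i, L i → (AddMonoidAlgebra K G)ˣ) :
    ∃ r : MvPolynomial (Σ i, L i) K, r ≠ 0 ∧
      ((∀ c, MvPolynomial.eval c r ≠ 0 → ∀ τ : AddMonoidAlgebra K G →ₐ[K] K,
          ¬ ∀ i, τ (linearSystem u c i) = 0) ∨
        (∀ c, MvPolynomial.eval c r ≠ 0 →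
          (∃ τ : AddMonoidAlgebra K G →ₐ[K] K, ∀ i, τ (linearSystem u c i) = 0) ∧
          ∀ p : Ideal (AddMonoidAlgebra K G), p.IsPrime → (∀ i, linearSystem u c i ∈ p) →
            (Nat.card ι : ℕ∞) ≤ p.height)) := by
  let l₀ : ∀ i, L i := fun i => Classical.arbitrary (L i)
  by_cases hinj : Function.Injective (incidenceMap K u l₀)
  · obtain ⟨r, hr0, hr⟩ := MvPolynomial.exists_ne_zero_forall_exists_algHom _ hinj
    choose s hs0 hs using fun f : Fin (m + 1 - Nat.card ι) → Fin m =>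
      exists_ne_zero_forall_not_algebraicIndependent u (trdeg_addMonoidAlgebra (K := K) b)
        (fun j => AddMonoidAlgebra.single (b (f j)) 1)
    refine ⟨r * ∏ f, s f, mul_ne_zero hr0 (Finset.prod_ne_zero_iff.2 fun f _ => hs0 f),
      Or.inr fun c hc => ?_⟩
    rw [map_mul, map_prod] at hc
    refine ⟨?_, fun p hp hmem => ?_⟩
    · obtain ⟨ψ, hψ⟩ := hr c (left_ne_zero_of_mul hc)
      refine ⟨ψ.comp (IsScalarTower.toAlgHom K _ _), fun i => ?_⟩
      exact map_linearSystem_eq_zero u l₀ c ψ hψ i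
    · refine le_height_of_not_algebraicIndependent b _ p fun f => ?_
      exact hs f c (Finset.prod_ne_zero_iff.1 (right_ne_zero_of_mul hc) f (Finset.mem_univ f))
        _ (Ideal.Quotient.mkₐ K p) fun i => Ideal.Quotient.eq_zero_iff_mem.2 (hmem i)
  · rw [injective_iff_map_eq_zero] at hinj
    push Not at hinj
    obtain ⟨r, hr, hr0⟩ := hinj
    refine ⟨r, hr0, Or.inl fun c hc τ hτ => hc ?_⟩
    obtain ⟨ψ, -, hψ⟩ := exists_algHom_incidenceMap u l₀ c τ hτ
    simpa [hr] using (hψ r).symm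

end GenericSystem

/-! ### Exponential varieties and their models -/

namespace ExpGeom

open Module

variable {V : Type*} [AddCommGroup V] [Module ℂ V]

theorem pullback_injective (G : AddSubgroup (Dual ℂ V)) : Function.Injective (pullback G) :=
  AddMonoidAlgebra.mapDomain_injective Subtype.val_injective

/-- Every rational point of the Laurent ring is evaluation at a point of the torus. -/
theorem exists_laurentEval_eq {G : AddSubgroup (Dual ℂ V)} (ψ : AddMonoidAlgebra ℂ G →ₐ[ℂ] ℂ) :
    ∃ τ : Torus G, laurentEval τ = ψ := by
  refine ⟨((AddMonoidAlgebra.lift ℂ ℂ G).symm ψ).toHomUnits, ?_⟩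
  apply (AddMonoidAlgebra.lift ℂ ℂ G).symm.injective
  rw [laurentEval, Equiv.symm_apply_apply]
  ext g
  simp

/-- Hilbert's Nullstellensatz on the torus. -/
theorem vanishingIdeal_torusVariety {G : AddSubgroup (Dual ℂ V)} (hG : G.FG) {ι : Type*}
    (P : ι → AddMonoidAlgebra ℂ G) :
    vanishingIdeal (torusVariety P) = (Ideal.span (Set.range P)).radical := by
  have : AddMonoid.FG G := AddGroup.fg_iff_addMonoid_fg.1 ((AddGroup.fg_iff_addSubgroup_fg G).2 hG)
  have : IsJacobsonRing (AddMonoidAlgebra ℂ G) := isJacobsonRing_of_finiteType (A := ℂ)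
  apply le_antisymm
  · rw [Ideal.radical_eq_jacobson, Ideal.jacobson]
    refine le_sInf fun M hM => ?_
    have := hM.2
    obtain ⟨ψ, hψ⟩ := Ideal.IsMaximal.exists_algHom_ker_eq (K := ℂ) M
    obtain ⟨τ, rfl⟩ := exists_laurentEval_eq ψ
    rw [← hψ]
    refine iInf₂_le_of_le τ (fun i => ?_) le_rfl
    rw [← RingHom.mem_ker, hψ]
    exact hM.1 (Ideal.subset_span (Set.mem_range_self i))
  · refine le_iInf₂ fun τ hτ => ?_
    have := RingHom.ker_isPrime (laurentEval τ)
    rw [Ideal.IsPrime.radical_le_iff inferInstance, Ideal.span_le]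
    rintro _ ⟨i, rfl⟩
    exact hτ i

/-- A polynomial in exponentials is an exponential sum. -/
theorem isExpHypersurface_eval_exp {σ : Type*} [Finite σ] {R : MvPolynomial σ ℂ} (hR : R ≠ 0) :
    IsExpHypersurface {a : σ → ℂ | MvPolynomial.eval (fun p => Complex.exp (a p)) R = 0} := by
  have := Fintype.ofFinite σ
  let E : MvPolynomial σ ℂ →ₐ[ℂ] ExpSum (σ → ℂ) :=
    MvPolynomial.aeval fun p => AddMonoidAlgebra.single (LinearMap.proj p) 1
  have hE : ∀ a, (E R).eval a = MvPolynomial.eval (fun p => Complex.exp (a p)) R := by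
    intro a
    have h : (AddMonoidAlgebra.lift ℂ ℂ (Dual ℂ (σ → ℂ)) (expChar a)).comp E =
        MvPolynomial.aeval (fun p => Complex.exp (a p)) := by
      apply MvPolynomial.algHom_ext
      intro p
      simp [E, expChar]
    have h1 := DFunLike.congr_fun h R
    rwa [MvPolynomial.aeval_eq_eval] at h1
  refine ⟨E R, ?_, by simp [hE]⟩
  -- A point with nonzero coordinates outside the zero set of `R` has the form `exp a`.
  have hne : R * ∏ p, MvPolynomial.X p ≠ 0 :=
    mul_ne_zero hR (Finset.prod_ne_zero_iff.2 fun p _ => MvPolynomial.X_ne_zero p)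
  obtain ⟨c, hc⟩ : ∃ c, MvPolynomial.eval c (R * ∏ p, MvPolynomial.X p) ≠ 0 := by
    by_contra! h
    exact hne (MvPolynomial.funext fun c => by simpa using h c)
  rw [map_mul, map_prod] at hc
  refine ⟨fun p => Complex.log (c p), ?_⟩
  rw [hE]
  have hcp : ∀ p, c p ≠ 0 := fun p => by
    simpa using Finset.prod_ne_zero_iff.1 (right_ne_zero_of_mul hc) p (Finset.mem_univ p)
  simpa [Complex.exp_log (hcp _)] using left_ne_zero_of_mul hc

/-- The codimension of a nonempty variety given by `k` equations is `k` if all its components have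
codimension at least `k`, by Krull's height theorem. -/
theorem codim_torusVariety_eq {G : AddSubgroup (Dual ℂ V)} (hG : G.FG) {ι : Type*} [Finite ι]
    (P : ι → AddMonoidAlgebra ℂ G) (hne : Ideal.span (Set.range P) ≠ ⊤)
    (h : ∀ p : Ideal (AddMonoidAlgebra ℂ G), p.IsPrime → (∀ i, P i ∈ p) →
      (Nat.card ι : ℕ∞) ≤ p.height) :
    codim (torusVariety P) = Nat.card ι := by
  have : AddMonoid.FG G := AddGroup.fg_iff_addMonoid_fg.1 ((AddGroup.fg_iff_addSubgroup_fg G).2 hG)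
  have : IsNoetherianRing (AddMonoidAlgebra ℂ G) := Algebra.FiniteType.isNoetherianRing ℂ _
  rw [codim, vanishingIdeal_torusVariety hG, Ideal.height_eq_inf_minimalPrimes,
    Ideal.radical_minimalPrimes]
  apply le_antisymm
  · rw [← Ideal.height_eq_inf_minimalPrimes]
    refine (Ideal.height_le_spanFinrank _ hne).trans ?_
    have hfin := Submodule.spanFinrank_span_le_ncard_of_finite
      (R := AddMonoidAlgebra ℂ G) (Set.finite_range P)
    exact_mod_cast hfin.trans (Finite.card_range_le P)
  · refine le_iInf₂ fun p hp => h p hp.1.1 fun i => hp.1.2 ?_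
    exact Ideal.subset_span (Set.mem_range_self i)

end ExpGeom

theorem mainTheorem7 (n k : ℕ) (hkn : k ≤ n)
    (Λ : Fin k → Finset (Module.Dual ℂ (Fin n → ℂ))) (hΛ : ∀ i, (Λ i).Nonempty) :
    ∃ R : MvPolynomial (Σ i : Fin k, {l // l ∈ Λ i}) ℂ,
      R ≠ 0 ∧
      ExpGeom.IsExpHypersurface {a : (Σ i : Fin k, {l // l ∈ Λ i}) → ℂ |
        MvPolynomial.eval (fun p => Complex.exp (a p)) R = 0} ∧
      ((∀ f : Fin k → ExpGeom.ExpSum (Fin n → ℂ), (∀ i, (f i).coeff.support ⊆ Λ i) →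
          MvPolynomial.eval (ExpGeom.coeffs Λ f) R ≠ 0 → ExpGeom.HasAlgCodim f k) ∨
       (∀ f : Fin k → ExpGeom.ExpSum (Fin n → ℂ), (∀ i, (f i).coeff.support ⊆ Λ i) →
          MvPolynomial.eval (ExpGeom.coeffs Λ f) R ≠ 0 → ExpGeom.HasEmptyModel f)) := by
  have : ∀ i, Nonempty {l // l ∈ Λ i} := fun i => (hΛ i).to_subtype
  set G₀ : AddSubgroup (Module.Dual ℂ (Fin n → ℂ)) :=
    AddSubgroup.closure (⋃ i, (Λ i : Set (Module.Dual ℂ (Fin n → ℂ)))) with hG₀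
  have hmem : ∀ i, ∀ l ∈ Λ i, l ∈ G₀ := fun i l hl =>
    AddSubgroup.subset_closure (Set.mem_iUnion.2 ⟨i, hl⟩)
  have hfg : G₀.FG :=
    ⟨(Set.finite_iUnion fun i => (Λ i).finite_toSet).toFinset, by rw [Set.Finite.coe_toFinset]⟩
  have : AddGroup.FG G₀ := (AddGroup.fg_iff_addSubgroup_fg G₀).2 hfg
  have : AddMonoid.FG G₀ := AddGroup.fg_iff_addMonoid_fg.1 this
  have : Module.Finite ℤ G₀ := Module.Finite.iff_addGroup_fg.2 ‹_›
  have : IsAddTorsionFree (Module.Dual ℂ (Fin n → ℂ)) := .of_isTorsionFree ℂ _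
  have : IsAddTorsionFree G₀ := inferInstance
  have : Module.Free ℤ G₀ := inferInstance
  have : IsDomain (AddMonoidAlgebra ℂ G₀) := NoZeroDivisors.to_isDomain _
  -- The monomials with exponents in `Λ i` are units of the Laurent ring of `G₀`.
  let u : ∀ i, {l // l ∈ Λ i} → (AddMonoidAlgebra ℂ G₀)ˣ := fun i l =>
    Units.map (AddMonoidAlgebra.of ℂ G₀) (toUnits (Multiplicative.ofAdd ⟨l.1, hmem i l.1 l.2⟩))
  have hu : ∀ i l, (u i l : AddMonoidAlgebra ℂ G₀)
    = AddMonoidAlgebra.single ⟨l.1, hmem i l.1 l.2⟩ 1 := fun i l => rfl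
  obtain ⟨r, hr0, hr⟩ := exists_resultant (K := ℂ) (Module.finBasis ℤ G₀) u
  -- The factor `∏ X p` makes all coefficients of `f` nonzero, so that a group containing the
  -- exponents of `f` contains `G₀`.
  refine ⟨r * ∏ p, MvPolynomial.X p, ?_, ?_, ?_⟩
  · exact mul_ne_zero hr0 (Finset.prod_ne_zero_iff.2 fun p _ => MvPolynomial.X_ne_zero p)
  · exact ExpGeom.isExpHypersurface_eval_exp
      (mul_ne_zero hr0 (Finset.prod_ne_zero_iff.2 fun p _ => MvPolynomial.X_ne_zero p))
  have key : ∀ f : Fin k → ExpGeom.ExpSum (Fin n → ℂ), (∀ i, (f i).coeff.support ⊆ Λ i) →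
      MvPolynomial.eval (ExpGeom.coeffs Λ f) (r * ∏ p, MvPolynomial.X p) ≠ 0 →
      MvPolynomial.eval (ExpGeom.coeffs Λ f) r ≠ 0 ∧
      ∀ (G : AddSubgroup (Module.Dual ℂ (Fin n → ℂ))) (P : Fin k → AddMonoidAlgebra ℂ G),
        (∀ i, ExpGeom.pullback G (P i) = f i) → ∃ h : G₀ ≤ G, ∀ i,
          P i = AddMonoidAlgebra.mapDomainAlgHom ℂ ℂ (AddSubgroup.inclusion h)
            (linearSystem u (ExpGeom.coeffs Λ f) i) := by
    intro f hf hR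
    rw [map_mul, map_prod] at hR
    have hc : ∀ i, ∀ l ∈ Λ i, (f i).coeff l ≠ 0 := fun i l hl => by
      simpa [ExpGeom.coeffs] using
        Finset.prod_ne_zero_iff.1 (right_ne_zero_of_mul hR) ⟨i, l, hl⟩ (Finset.mem_univ _)
    refine ⟨left_ne_zero_of_mul hR, fun G P hP => ?_⟩
    have hle : G₀ ≤ G := by
      rw [hG₀, AddSubgroup.closure_le, Set.iUnion_subset_iff]
      intro i l hl
      by_contra hlG
      refine hc i l hl ?_
      rw [← hP]
      exact Finsupp.mapDomain_of_notMem_range _ _ (by simpa using hlG)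
    refine ⟨hle, fun i => ExpGeom.pullback_injective G ?_⟩
    have hcomp : (ExpGeom.pullback G).comp
        (AddMonoidAlgebra.mapDomainAlgHom ℂ ℂ (AddSubgroup.inclusion hle)) =
        ExpGeom.pullback G₀ := by
      apply AddMonoidAlgebra.algHom_ext'
      · refine MonoidHom.ext fun g => ?_
        simp [ExpGeom.pullback]
      · exact Subsingleton.elim _ _
    rw [hP, ← AlgHom.comp_apply, hcomp, linearSystem, map_sum]
    have hsingle : ∀ l : {l // l ∈ Λ i}, ExpGeom.pullback G₀ (ExpGeom.coeffs Λ f ⟨i, l⟩ •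
        (u i l : AddMonoidAlgebra ℂ G₀)) = AddMonoidAlgebra.single l.1 ((f i).coeff l.1) := by
      intro l
      rw [hu, AddMonoidAlgebra.smul_single, smul_eq_mul, mul_one]
      exact AddMonoidAlgebra.mapDomain_single
    rw [Finset.sum_congr rfl fun l _ => hsingle l,
      Finset.sum_coe_sort (Λ i) fun l => AddMonoidAlgebra.single l ((f i).coeff l)]
    apply AddMonoidAlgebra.coeff_injective
    rw [AddMonoidAlgebra.coeff_sum]
    exact ((f i).coeff.sum_single.symm.trans
      (Finsupp.sum_of_support_subset _ (hf i) _ (by simp)))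
  rcases hr with hr | hr
  · refine Or.inr fun f hf hR G Z hGZ => ?_
    obtain ⟨hG, -, P, hP, hZ⟩ := hGZ
    obtain ⟨hrf, hkey⟩ := key f hf hR
    obtain ⟨hle, hPj⟩ := hkey G P hP
    rw [hZ, Set.eq_empty_iff_forall_notMem]
    intro τ hτ
    refine hr _ hrf ((ExpGeom.laurentEval τ).comp
      (AddMonoidAlgebra.mapDomainAlgHom ℂ ℂ (AddSubgroup.inclusion hle))) fun i => ?_
    rw [AlgHom.comp_apply, ← hPj]
    exact hτ i
  · refine Or.inl fun f hf hR G Z hGZ => ?_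
    obtain ⟨hG, -, P, hP, hZ⟩ := hGZ
    obtain ⟨hrf, hkey⟩ := key f hf hR
    obtain ⟨hle, hPj⟩ := hkey G P hP
    obtain ⟨⟨τ, hτ⟩, hht⟩ := hr _ hrf
    let _ := (AddMonoidAlgebra.mapDomainAlgHom ℂ ℂ (AddSubgroup.inclusion hle)).toAlgebra
    have hff : Module.FaithfullyFlat (AddMonoidAlgebra ℂ G₀) (AddMonoidAlgebra ℂ G) :=
      faithfullyFlat_mapDomainAlgHom _ (AddSubgroup.inclusion_injective hle)
    have hcodim := ExpGeom.codim_torusVariety_eq hG P ?_ ?_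
    · rw [hZ, hcodim, Nat.card_fin]
    · have hspan : Ideal.span (Set.range P) = (Ideal.span (Set.range
          (linearSystem u (ExpGeom.coeffs Λ f)))).map (algebraMap _ (AddMonoidAlgebra ℂ G)) := by
        rw [Ideal.map_span, ← Set.range_comp]
        congr 2
        exact funext hPj
      rw [hspan]
      intro htop
      have h1 := Ideal.comap_map_eq_self_of_faithfullyFlat (B := AddMonoidAlgebra ℂ G)
        (Ideal.span (Set.range (linearSystem u (ExpGeom.coeffs Λ f))))
      rw [htop, Ideal.comap_top] at h1
      have h2 : Ideal.span (Set.range (linearSystem u (ExpGeom.coeffs Λ f))) ≤ RingHom.ker τ := by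
        rw [Ideal.span_le]
        rintro _ ⟨i, rfl⟩
        exact hτ i
      rw [← h1] at h2
      exact RingHom.ker_ne_top τ (top_le_iff.1 h2)
    · intro p hp hPp
      have : AddMonoid.FG G :=
        AddGroup.fg_iff_addMonoid_fg.1 ((AddGroup.fg_iff_addSubgroup_fg G).2 hG)
      have : IsNoetherianRing (AddMonoidAlgebra ℂ G) := Algebra.FiniteType.isNoetherianRing ℂ _
      have : IsNoetherianRing (AddMonoidAlgebra ℂ G₀) := Algebra.FiniteType.isNoetherianRing ℂ _
      refine (hht (p.under (AddMonoidAlgebra ℂ G₀)) inferInstance fun i => ?_).trans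
        (Ideal.height_under_le p)
      have hi := hPp i
      rw [hPj] at hi
      exact hi
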